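/- **Model.** A sporadic task $\tau_i$ has worst-case execution time $C_i>0$, relative deadline $D_i>0$ and minimum inter-arrival time $T_i>0$, with no relation imposed between $D_i$ and $T_i$ (arbitrary deadlines). It releases an infinite sequence of jobs whose arrival times are separated by at least $T_i$; each job needs at most $C_i$ units of execution (at unit speed) and has to finish at most $D_i$ time units after its arrival. Jobs are executed on $M$ identical processors, with preemption and migration allowed; at every instant at most one job of each task executes, on at most one processor. On processors of speed $s$, a job that executes for $x$ time units receives $sx$ units of execution. A finite task set is feasible on $M$ processors of speed $s$ if every job sequence it can release has a schedule in which all deadlines are met. Global deadline-monotonic (DM) scheduling gives the tasks unique fixed priorities such that $\tau_i$ has higher priority than $\tau_j$ only if $D_i\le D_j$ (ties broken arbitrarily), serves the jobs of each task in order of arrival, and at every instant executes the $M$ highest-priority ready jobs (all of them if there are at most $M$). **Theorem.** Let $M\ge 2$. Global DM has a speedup bound of $3-\frac1M$ with respect to the optimal schedule: if a finite sporadic task set with arbitrary deadlines is feasible on $M$ identical processors of speed $1$, then, for every job sequence the task set can release, global DM on $M$ identical processors of speed $3-\frac1M$ (with any tie-breaking) produces a schedule that meets all deadlines. -/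

import Mathlib

open MeasureTheory

namespace GlobalScheduling

/-- A sporadic task: worst-case execution time `C` (on a unit-speed processor), relative deadline
`D` and minimum inter-arrival time `T`.  No relation between `D` and `T` is imposed
(arbitrary deadlines). -/
structure SporadicTask where
  C : ℝ
  D : ℝ
  T : ℝ
  C_pos : 0 < C
  D_pos : 0 < D
  T_pos : 0 < T

/-- A finite set of `N` sporadic tasks. -/
abbrev TaskSet (N : ℕ) := Fin N → SporadicTask

/-- One run-time behaviour of `N` tasks: job `j` of task `i` arrives at time `release i j` and
needs `exec i j` units of execution on a unit-speed processor. -/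
structure JobSeq (N : ℕ) where
  release : Fin N → ℕ → ℝ
  exec : Fin N → ℕ → ℝ

/-- The job sequence can be generated by the task set: consecutive jobs of a task are separated by
at least its minimum inter-arrival time and no job exceeds its worst-case execution time. -/
structure JobSeq.IsLegal {N : ℕ} (J : JobSeq N) (τ : TaskSet N) : Prop where
  separation : ∀ i j, J.release i j + (τ i).T ≤ J.release i (j + 1)
  exec_nonneg : ∀ i j, 0 ≤ J.exec i j
  exec_le : ∀ i j, J.exec i j ≤ (τ i).C

/-- A schedule on `M` processors: `σ p t` is the job (task index, job index) that processor `p`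
executes at time `t`, or `none` if the processor idles. -/
abbrev Schedule (M N : ℕ) := Fin M → ℝ → Option (Fin N × ℕ)

/-- Job `j` of task `i` executes on some processor at time `t`. -/
def Schedule.Runs {M N : ℕ} (σ : Schedule M N) (i : Fin N) (j : ℕ) (t : ℝ) : Prop :=
  ∃ p, σ p t = some (i, j)

/-- Amount of execution that job `j` of task `i` has received before time `t` when every processor
runs at speed `s`. -/
noncomputable def Schedule.service {M N : ℕ} (σ : Schedule M N) (s : ℝ) (i : Fin N) (j : ℕ)
    (t : ℝ) : ℝ :=
  s * volume.real {u : ℝ | u < t ∧ σ.Runs i j u}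

/-- Job `j` of task `i` is finished at time `t`. -/
def Schedule.Finished {M N : ℕ} (σ : Schedule M N) (s : ℝ) (J : JobSeq N) (i : Fin N) (j : ℕ)
    (t : ℝ) : Prop :=
  J.exec i j ≤ σ.service s i j t

/-- Legal preemptive schedules with migration on processors of speed `s`: jobs execute only between
their arrival and their completion, and at every instant at most one job of each task executes, on
at most one processor. -/
structure Schedule.IsValid {M N : ℕ} (σ : Schedule M N) (s : ℝ) (J : JobSeq N) : Prop where
  measurable : ∀ p i j, MeasurableSet {t : ℝ | σ p t = some (i, j)}
  sequential : ∀ p q t i j j', σ p t = some (i, j) → σ q t = some (i, j') → p = q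
  arrived : ∀ i j t, σ.Runs i j t → J.release i j ≤ t
  unfinished : ∀ i j t, σ.Runs i j t → ¬ σ.Finished s J i j t

/-- Every job is finished at its absolute deadline. -/
def Schedule.MeetsDeadlines {M N : ℕ} (σ : Schedule M N) (s : ℝ) (τ : TaskSet N)
    (J : JobSeq N) : Prop :=
  ∀ i j, σ.Finished s J i j (J.release i j + (τ i).D)

/-- The task set can be feasibly scheduled on `M` processors of speed `s` by an optimal (even
clairvoyant) scheduler: every job sequence that it can generate has a legal schedule that meets
all deadlines. -/
def Feasible (M : ℕ) (s : ℝ) {N : ℕ} (τ : TaskSet N) : Prop :=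
  ∀ J : JobSeq N, J.IsLegal τ → ∃ σ : Schedule M N, σ.IsValid s J ∧ σ.MeetsDeadlines s τ J

/-- A scheduling algorithm for `M` processors, given by the relation that, for a task set, a
processor speed and a job sequence, holds for the schedules that the algorithm may produce. -/
abbrev SchedulingAlgorithm (M : ℕ) :=
  ∀ N : ℕ, TaskSet N → ℝ → JobSeq N → Schedule M N → Prop

/-- On `M` processors of speed `s`, the algorithm always produces a legal schedule for the jobs of
the task set, and whatever it produces is legal and meets all deadlines. -/
def SchedulingAlgorithm.Schedules {M : ℕ} (A : SchedulingAlgorithm M) (s : ℝ) {N : ℕ}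
    (τ : TaskSet N) : Prop :=
  ∀ J : JobSeq N, J.IsLegal τ →
    (∃ σ : Schedule M N, A N τ s J σ) ∧
    ∀ σ : Schedule M N, A N τ s J σ → σ.IsValid s J ∧ σ.MeetsDeadlines s τ J

/-- `s` is a speedup bound of the algorithm with respect to the optimal schedule: whatever is
feasible on `M` unit-speed processors is scheduled by the algorithm on `M` processors of
speed `s`. -/
def SchedulingAlgorithm.HasSpeedupBound {M : ℕ} (A : SchedulingAlgorithm M) (s : ℝ) : Prop :=
  ∀ (N : ℕ) (τ : TaskSet N), Feasible M 1 τ → A.Schedules s τ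

/-- Job `j` of task `i` is ready at time `t`: it has arrived, it is not finished, and all earlier
jobs of the same task are finished (the jobs of one task are served in order of arrival). -/
def Schedule.Ready {M N : ℕ} (σ : Schedule M N) (s : ℝ) (J : JobSeq N) (i : Fin N) (j : ℕ)
    (t : ℝ) : Prop :=
  J.release i j ≤ t ∧ ¬ σ.Finished s J i j t ∧ ∀ j' < j, σ.Finished s J i j' t

/-- A rule that gives every task of every task set a static priority level; a smaller number is a
higher priority. -/
abbrev PriorityRule := ∀ N : ℕ, TaskSet N → Fin N → ℕ

/-- Deadline-monotonic priorities: priority levels are unique and a task of higher priority never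
has a larger relative deadline.  Ties between equal deadlines are broken arbitrarily. -/
structure PriorityRule.IsDeadlineMonotonic (prio : PriorityRule) : Prop where
  unique : ∀ (N : ℕ) (τ : TaskSet N), Function.Injective (prio N τ)
  monotone : ∀ (N : ℕ) (τ : TaskSet N) (i k : Fin N),
    prio N τ i < prio N τ k → (τ i).D ≤ (τ k).D

/-- Global fixed-priority preemptive scheduling on `M` processors: at every instant the `M`
highest-priority ready jobs (all of them, if there are at most `M`) execute.  That is, only ready
jobs execute, and a ready job waits only while every processor executes a job of higher
priority. -/
def globalFixedPriority (M : ℕ) (prio : PriorityRule) : SchedulingAlgorithm M :=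
  fun N τ s J σ =>
    σ.IsValid s J ∧
    (∀ i j t, σ.Runs i j t → σ.Ready s J i j t) ∧
    (∀ i j t, σ.Ready s J i j t → ¬ σ.Runs i j t →
      ∀ p, ∃ i' j', σ p t = some (i', j') ∧ prio N τ i' < prio N τ i)

end GlobalScheduling

open MeasureTheory

namespace GlobalScheduling

/-! Suppose a job of task `k` misses its deadline `d`. Let `u` be the start of the interval up to
`d` in which `k` is continuously pending, let `H` be `k` together with the tasks of higher priority,
and let `s = 3 - 1/M`. Whenever `k` is pending but idle, `M` other tasks of `H` run; moreover `k`
receives less than `d - u` units of execution, since feasibility bounds the demand of a single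
sequential task (`exists_busy_start_of_miss`). As `M * s = 2M + (M - 1)`, the tasks of `H` receive
more than `2M(d - u)` units in `[u, d)`.

Extend the interval to the left, to the `t₀ ≤ u` that maximizes the excess of the work of `H` in
`[t₀, d)` over `2M(d - t₀)`; the excess stays positive. Maximality limits carry-in. If a task `i` of
`H` is continuously pending in `[v, t₀)`, then `H` does at most `2M(t₀ - v)` work there, so the
counting argument run backwards gives `i` at least `t₀ - v` units. Since its utilization is at most
1, its backlog is paid off: in `[t₀, d)` it receives less than `C + (C / T)(d - t₀)`. Summing over
`H`, feasibility bounds the `C` terms by `M * D` with `D` the deadline of `k`, where `D ≤ d - t₀`,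
and the utilizations by `M`. The total is below `2M(d - t₀)`, a contradiction.

That a schedule exists at all is a separate construction, by recursion on priority and, within a
task, on the job index (`exists_globalFixedPriority`). -/

/-- Measure of the part of `A` that lies before time `t`. -/
noncomputable def timeBefore (A : Set ℝ) (t : ℝ) : ℝ := volume.real (A ∩ Set.Iio t)

/-! ### Measure of a set of times before a given instant. -/

section TimeBefore

variable {A : Set ℝ} {r : ℝ}

lemma timeBefore_nonneg (A : Set ℝ) (t : ℝ) : 0 ≤ timeBefore A t := measureReal_nonneg

lemma volume_inter_Iio_ne_top (hr : A ⊆ Set.Ici r) (t : ℝ) : volume (A ∩ Set.Iio t) ≠ ⊤ :=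
  measure_ne_top_of_subset (show A ∩ Set.Iio t ⊆ Set.Ico r t from
    fun _ hx => ⟨hr hx.1, hx.2⟩) (by simp)

lemma volume_inter_Ico_ne_top (A : Set ℝ) (a b : ℝ) : volume (A ∩ Set.Ico a b) ≠ ⊤ :=
  measure_ne_top_of_subset Set.inter_subset_right (by simp)

lemma timeBefore_add (hA : MeasurableSet A) (hr : A ⊆ Set.Ici r) {a b : ℝ} (hab : a ≤ b) :
    timeBefore A b = timeBefore A a + volume.real (A ∩ Set.Ico a b) := by
  have h : A ∩ Set.Iio b = (A ∩ Set.Iio a) ∪ (A ∩ Set.Ico a b) := by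
    rw [← Set.inter_union_distrib_left, Set.Iio_union_Ico_eq_Iio hab]
  unfold timeBefore
  rw [h, measureReal_union _ (hA.inter measurableSet_Ico) (volume_inter_Iio_ne_top hr a)
    (volume_inter_Ico_ne_top A a b)]
  exact (Set.disjoint_left.2 fun x hx hy => not_le.2 hx.2 hy.2.1)

lemma volume_inter_Ico_le (A : Set ℝ) {a b : ℝ} (hab : a ≤ b) :
    volume.real (A ∩ Set.Ico a b) ≤ b - a := by
  calc volume.real (A ∩ Set.Ico a b) ≤ volume.real (Set.Ico a b) :=
        measureReal_mono Set.inter_subset_right (by simp)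
    _ = b - a := Real.volume_real_Ico_of_le hab

lemma timeBefore_mono (hA : MeasurableSet A) (hr : A ⊆ Set.Ici r) : Monotone (timeBefore A) :=
  fun a b hab => by
    rw [timeBefore_add hA hr hab]
    linarith [measureReal_nonneg (μ := volume) (s := A ∩ Set.Ico a b)]

lemma continuous_timeBefore (hA : MeasurableSet A) (hr : A ⊆ Set.Ici r) :
    Continuous (timeBefore A) := by
  have h : LipschitzWith 1 (timeBefore A) := by
    refine LipschitzWith.of_le_add fun x y => ?_
    rcases le_total x y with h | h
    · linarith [timeBefore_mono hA hr h, dist_nonneg (x := x) (y := y)]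
    · rw [timeBefore_add hA hr h, Real.dist_eq]
      linarith [volume_inter_Ico_le A h, le_abs_self (x - y)]
  exact h.continuous

lemma timeBefore_of_le (hr : A ⊆ Set.Ici r) {t : ℝ} (ht : t ≤ r) : timeBefore A t = 0 := by
  have : A ∩ Set.Iio t = ∅ := by
    ext x
    simp only [Set.mem_inter_iff, Set.mem_Iio, Set.mem_empty_iff_false, iff_false, not_and, not_lt]
    exact fun hx => ht.trans (hr hx)
  simp [timeBefore, this]

/-- If every point of `A` is preceded by less than `c` of `A`, then `A` has at most measure `c`
before any time. -/
lemma timeBefore_le_of_forall_lt (hA : MeasurableSet A) (hr : A ⊆ Set.Ici r) {c : ℝ} (hc : 0 ≤ c)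
    (h : ∀ u ∈ A, timeBefore A u < c) (t : ℝ) : timeBefore A t ≤ c := by
  by_contra! hlt
  have hrt : r ≤ t := by
    by_contra! h'
    rw [timeBefore_of_le hr h'.le] at hlt
    linarith
  -- At the instant `t₁` where the measure equals `c`, the set must already be exhausted.
  obtain ⟨t₁, ht₁, he⟩ := intermediate_value_Icc hrt (continuous_timeBefore hA hr).continuousOn
    ⟨(timeBefore_of_le hr le_rfl).trans_le hc, hlt.le⟩
  have hempty : A ∩ Set.Ico t₁ t = ∅ := by
    ext u
    simp only [Set.mem_inter_iff, Set.mem_Ico, Set.mem_empty_iff_false, iff_false]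
    rintro ⟨hu, h1, -⟩
    linarith [h u hu, timeBefore_mono hA hr h1]
  have := timeBefore_add hA hr ht₁.2
  rw [hempty, measureReal_empty] at this
  linarith

/-- Pairwise disjoint subsets of an interval have total measure at most its length. -/
lemma sum_volume_le_of_pairwiseDisjoint {ι : Type*} (F : Finset ι) (A : ι → Set ℝ) {a b : ℝ}
    (hab : a ≤ b) (hA : ∀ i ∈ F, MeasurableSet (A i))
    (hd : (F : Set ι).PairwiseDisjoint A) :
    ∑ i ∈ F, volume.real (A i ∩ Set.Ico a b) ≤ b - a := by
  rw [← measureReal_biUnion_finset (fun i hi j hj hij => (hd hi hj hij).mono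
    Set.inter_subset_left Set.inter_subset_left)
    (fun i hi => (hA i hi).inter measurableSet_Ico) (fun i _ => volume_inter_Ico_ne_top _ a b)]
  rw [← Real.volume_real_Ico_of_le hab]
  exact measureReal_mono (Set.iUnion₂_subset fun i _ => Set.inter_subset_right) (by simp)

end TimeBefore

/-! ### Service in valid schedules. -/

section Valid

variable {M N : ℕ} {σ : Schedule M N} {s : ℝ} {J : JobSeq N}

lemma Schedule.service_eq (σ : Schedule M N) (s : ℝ) (i : Fin N) (j : ℕ) (t : ℝ) :
    σ.service s i j t = s * timeBefore {u | σ.Runs i j u} t := by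
  unfold Schedule.service timeBefore
  congr 2
  ext u
  exact and_comm

lemma Schedule.IsValid.measurableSet_runs (h : σ.IsValid s J) (i : Fin N) (j : ℕ) :
    MeasurableSet {t | σ.Runs i j t} := by
  have : {t | σ.Runs i j t} = ⋃ p, {t | σ p t = some (i, j)} := by
    ext t; simp [Schedule.Runs]
  rw [this]
  exact MeasurableSet.iUnion fun p => h.measurable p i j

lemma Schedule.IsValid.runs_subset (h : σ.IsValid s J) (i : Fin N) (j : ℕ) :
    {t | σ.Runs i j t} ⊆ Set.Ici (J.release i j) := fun t ht => h.arrived i j t ht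

lemma Schedule.IsValid.service_le (h : σ.IsValid s J) (hs : 0 < s) {i : Fin N} {j : ℕ}
    (he : 0 ≤ J.exec i j) (t : ℝ) : σ.service s i j t ≤ J.exec i j := by
  have := timeBefore_le_of_forall_lt (h.measurableSet_runs i j) (h.runs_subset i j)
    (c := J.exec i j / s) (by positivity) (fun u hu => by
      have := h.unfinished i j u hu
      rw [Schedule.Finished, not_le, Schedule.service_eq] at this
      rw [lt_div_iff₀ hs]; linarith) t
  rw [Schedule.service_eq]
  rw [le_div_iff₀ hs] at this
  linarith

lemma Schedule.IsValid.finished_mono (h : σ.IsValid s J) (hs : 0 ≤ s) {i : Fin N} {j : ℕ}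
    {t t' : ℝ} (htt : t ≤ t') (hf : σ.Finished s J i j t) : σ.Finished s J i j t' := by
  unfold Schedule.Finished at *
  rw [Schedule.service_eq] at *
  exact hf.trans (mul_le_mul_of_nonneg_left
    (timeBefore_mono (h.measurableSet_runs i j) (h.runs_subset i j) htt) hs)

end Valid

/-! ### Necessary conditions for feasibility. -/

section Feasible

variable {M N : ℕ} {τ : TaskSet N}

/-- The synchronous periodic job sequence in which all jobs need their worst-case execution
time. -/
def periodicJobs (τ : TaskSet N) : JobSeq N where
  release i j := j * (τ i).T
  exec i _ := (τ i).C

lemma periodicJobs_isLegal (τ : TaskSet N) : (periodicJobs τ).IsLegal τ where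
  separation i j := by simp only [periodicJobs]; push_cast; linarith
  exec_nonneg i _ := (τ i).C_pos.le
  exec_le _ _ := le_rfl

lemma Schedule.C_le_volume_runs {σ : Schedule M N} (hv : σ.IsValid 1 (periodicJobs τ))
    (hd : σ.MeetsDeadlines 1 τ (periodicJobs τ)) {i : Fin N} {j : ℕ} {t : ℝ}
    (ht : j * (τ i).T + (τ i).D ≤ t) :
    (τ i).C ≤ volume.real ({u | σ.Runs i j u} ∩ Set.Ico 0 t) := by
  have h := hd i j
  rw [Schedule.Finished, Schedule.service_eq, one_mul] at h
  refine h.trans (measureReal_mono (fun u hu => ⟨hu.1, ?_, lt_of_lt_of_le hu.2 ht⟩)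
    (volume_inter_Ico_ne_top _ _ _))
  have := hv.arrived i j u hu.1
  exact le_trans (mul_nonneg j.cast_nonneg (τ i).T_pos.le) this

/-- In the synchronous periodic sequence, the counted jobs must all run to completion inside `[0,
t)`, where `M` unit-speed processors offer `M * t`. -/
lemma Feasible.demand_le (h : Feasible M 1 τ) (n : Fin N → ℕ) {t : ℝ} (h0 : 0 ≤ t)
    (ht : ∀ i, ∀ j < n i, j * (τ i).T + (τ i).D ≤ t) :
    ∑ i, n i * (τ i).C ≤ M * t := by
  obtain ⟨σ, hv, hd⟩ := h _ (periodicJobs_isLegal τ)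
  let F : Finset (Σ _ : Fin N, ℕ) := Finset.univ.sigma fun i => Finset.range (n i)
  calc ∑ i, n i * (τ i).C = ∑ x ∈ F, (τ x.1).C := by
        simp [F, Finset.sum_sigma]
    _ ≤ ∑ x ∈ F, ∑ p, volume.real ({u | σ p u = some (x.1, x.2)} ∩ Set.Ico 0 t) := by
        refine Finset.sum_le_sum fun x hx => ?_
        have hx' : x.2 < n x.1 := by simpa [F] using hx
        refine (Schedule.C_le_volume_runs hv hd (ht x.1 x.2 hx')).trans ?_
        have : {u | σ.Runs x.1 x.2 u} ∩ Set.Ico 0 t =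
            ⋃ p, ({u | σ p u = some (x.1, x.2)} ∩ Set.Ico 0 t) := by
          ext u; simp [Schedule.Runs]
        rw [this]
        exact measureReal_iUnion_fintype_le _
    _ = ∑ p, ∑ x ∈ F, volume.real ({u | σ p u = some (x.1, x.2)} ∩ Set.Ico 0 t) :=
        Finset.sum_comm
    _ ≤ ∑ _p : Fin M, (t - 0) := by
        refine Finset.sum_le_sum fun p _ => ?_
        refine sum_volume_le_of_pairwiseDisjoint F (fun x => {u | σ p u = some (x.1, x.2)}) h0
          (fun x _ => hv.measurable p x.1 x.2) ?_
        intro x _ y _ hxy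
        refine Set.disjoint_left.2 fun u hx hy => hxy ?_
        have : (x.1, x.2) = (y.1, y.2) := Option.some.inj (hx.symm.trans hy)
        rw [Prod.mk.injEq] at this
        exact Sigma.ext this.1 (heq_of_eq this.2)
    _ = M * t := by simp

/-- Jobs of one task never run in parallel, so their execution sets are disjoint and fit into the
length of the window. This replaces `C ≤ D` when several jobs of a task can be pending together. -/
lemma Feasible.task_demand_le (h : Feasible M 1 τ) (i : Fin N) (n : ℕ) :
    (n + 1) * (τ i).C ≤ n * (τ i).T + (τ i).D := by
  obtain ⟨σ, hv, hd⟩ := h _ (periodicJobs_isLegal τ)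
  set t := n * (τ i).T + (τ i).D
  have h0 : 0 ≤ t := add_nonneg (mul_nonneg n.cast_nonneg (τ i).T_pos.le) (τ i).D_pos.le
  calc (n + 1) * (τ i).C = ∑ _j ∈ Finset.range (n + 1), (τ i).C := by simp
    _ ≤ ∑ j ∈ Finset.range (n + 1), volume.real ({u | σ.Runs i j u} ∩ Set.Ico 0 t) := by
        refine Finset.sum_le_sum fun j hj => Schedule.C_le_volume_runs hv hd ?_
        have : (j : ℝ) ≤ n := by exact_mod_cast Nat.lt_succ_iff.1 (Finset.mem_range.1 hj)
        have := mul_le_mul_of_nonneg_right this (τ i).T_pos.le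
        simp only [t]; linarith
    _ ≤ t - 0 := by
        refine sum_volume_le_of_pairwiseDisjoint _ (fun j => {u | σ.Runs i j u}) h0
          (fun j _ => hv.measurableSet_runs i j) ?_
        intro j _ j' _ hj
        refine Set.disjoint_left.2 ?_
        rintro u ⟨p, hp⟩ ⟨q, hq⟩
        obtain rfl := hv.sequential p q u i j j' hp hq
        rw [hp] at hq
        simp_all
    _ = t := sub_zero t

/-- A linear function that stays below another one up to a constant has a smaller slope. -/
lemma le_of_forall_mul_le_mul_add {a b c : ℝ} (h : ∀ n : ℕ, n * a ≤ n * b + c) : a ≤ b := by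
  by_contra! hlt
  obtain ⟨n, hn⟩ := exists_nat_gt (c / (a - b))
  rw [div_lt_iff₀ (by linarith)] at hn
  linarith [h n]

lemma Feasible.C_le_T (h : Feasible M 1 τ) (i : Fin N) : (τ i).C ≤ (τ i).T :=
  le_of_forall_mul_le_mul_add (c := (τ i).D) fun n => by
    linarith [h.task_demand_le i n, (τ i).C_pos]

lemma Feasible.sum_C_le (h : Feasible M 1 τ) (H : Finset (Fin N)) {d : ℝ} (h0 : 0 ≤ d)
    (hH : ∀ i ∈ H, (τ i).D ≤ d) : ∑ i ∈ H, (τ i).C ≤ M * d := by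
  have := h.demand_le (fun i => if i ∈ H then 1 else 0) h0 (fun i j hj => by
    by_cases hi : i ∈ H
    · simp only [hi, if_true, Nat.lt_one_iff] at hj
      subst hj
      simpa using hH i hi
    · simp [hi] at hj)
  simpa [Finset.sum_ite_mem] using this

lemma Feasible.sum_utilization_le (h : Feasible M 1 τ) : ∑ i, (τ i).C / (τ i).T ≤ M := by
  refine le_of_forall_mul_le_mul_add (c := M * ∑ i, (τ i).D) fun n => ?_
  have hD : ∀ i, (τ i).D ≤ ∑ i, (τ i).D :=
    fun i => Finset.single_le_sum (fun k _ => (τ k).D_pos.le) (Finset.mem_univ i)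
  have h0 : 0 ≤ ∑ i, (τ i).D := Finset.sum_nonneg fun k _ => (τ k).D_pos.le
  -- The counted jobs arrive before time `n`; the sum of all deadlines is a crude slack, constant in
  -- `n`, that covers each of them.
  have := h.demand_le (fun i => ⌈n / (τ i).T⌉₊) (t := n + ∑ i, (τ i).D) (by positivity)
    (fun i j hj => by
      have := Nat.lt_ceil.1 hj
      rw [lt_div_iff₀ (τ i).T_pos] at this
      linarith [hD i])
  rw [mul_comm (n : ℝ) (M : ℝ), ← mul_add]
  refine le_trans ?_ this
  rw [Finset.mul_sum]
  refine Finset.sum_le_sum fun i _ => ?_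
  have := mul_le_mul_of_nonneg_right (Nat.le_ceil ((n : ℝ) / (τ i).T)) (τ i).C_pos.le
  refine le_trans (le_of_eq ?_) this
  ring

end Feasible

/-! ### Arrival times of legal job sequences. -/

section Legal

variable {N : ℕ} {J : JobSeq N} {τ : TaskSet N}

lemma JobSeq.IsLegal.release_add_le (h : J.IsLegal τ) (i : Fin N) (j n : ℕ) :
    J.release i j + n * (τ i).T ≤ J.release i (j + n) := by
  induction n with
  | zero => simp
  | succ n ih =>
    have := h.separation i (j + n)
    rw [← add_assoc]
    push_cast
    linarith

lemma JobSeq.IsLegal.release_mono (h : J.IsLegal τ) (i : Fin N) : Monotone (J.release i) :=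
  monotone_nat_of_le_succ fun j => by linarith [h.separation i j, (τ i).T_pos]

lemma JobSeq.IsLegal.exists_le_release (h : J.IsLegal τ) (i : Fin N) (t : ℝ) :
    ∃ n, t ≤ J.release i n := by
  obtain ⟨n, hn⟩ := exists_nat_gt ((t - J.release i 0) / (τ i).T)
  rw [div_lt_iff₀ (τ i).T_pos] at hn
  have := h.release_add_le i 0 n
  rw [zero_add] at this
  exact ⟨n, by linarith⟩

lemma JobSeq.IsLegal.exists_forall_le_release (h : J.IsLegal τ) :
    ∃ B, ∀ i j, B ≤ J.release i j := by
  obtain ⟨B, hB⟩ := (Set.finite_range fun i => J.release i 0).bddBelow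
  exact ⟨B, fun i j => (hB ⟨i, rfl⟩).trans (h.release_mono i (Nat.zero_le j))⟩

end Legal

/-! ### Deadline misses are impossible at speed `3 - 1/M`. -/

section Analysis

variable {M N : ℕ} {σ : Schedule M N} {s : ℝ} {J : JobSeq N} {τ : TaskSet N}

/-- The times at which some job of task `i` executes. -/
def Schedule.busyTimes (σ : Schedule M N) (i : Fin N) : Set ℝ := {t | ∃ j, σ.Runs i j t}

/-- Task `i` has an arrived but unfinished job at time `t`. -/
def Schedule.Pending (σ : Schedule M N) (s : ℝ) (J : JobSeq N) (i : Fin N) (t : ℝ) : Prop :=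
  ∃ j, J.release i j ≤ t ∧ ¬ σ.Finished s J i j t

/-- Length of time during which task `i` executes in the interval `[a, b)`. -/
noncomputable def Schedule.runTime (σ : Schedule M N) (i : Fin N) (a b : ℝ) : ℝ :=
  volume.real (σ.busyTimes i ∩ Set.Ico a b)

lemma Schedule.IsValid.measurableSet_busyTimes (h : σ.IsValid s J) (i : Fin N) :
    MeasurableSet (σ.busyTimes i) := by
  have : σ.busyTimes i = ⋃ j, {t | σ.Runs i j t} := by ext t; simp [Schedule.busyTimes]
  rw [this]
  exact MeasurableSet.iUnion fun j => h.measurableSet_runs i j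

lemma Schedule.IsValid.busyTimes_subset (h : σ.IsValid s J) {B : ℝ}
    (hB : ∀ i j, B ≤ J.release i j) (i : Fin N) : σ.busyTimes i ⊆ Set.Ici B := by
  rintro t ⟨j, hj⟩
  exact (hB i j).trans (h.arrived i j t hj)

lemma Schedule.IsValid.runTime_add (h : σ.IsValid s J) (i : Fin N) {a b c : ℝ} (hab : a ≤ b)
    (hbc : b ≤ c) : σ.runTime i a c = σ.runTime i a b + σ.runTime i b c := by
  unfold Schedule.runTime
  rw [← Set.Ico_union_Ico_eq_Ico hab hbc, Set.inter_union_distrib_left,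
    measureReal_union _ ((h.measurableSet_busyTimes i).inter measurableSet_Ico)
    (volume_inter_Ico_ne_top _ _ _) (volume_inter_Ico_ne_top _ _ _)]
  exact Set.disjoint_left.2 fun x hx hy => not_le.2 hx.2.2 hy.2.1

/-- The beginning of the interval, ending at `t₀`, in which a task is continuously pending. -/
lemma Schedule.IsValid.exists_busy_start (h : σ.IsValid s J) (hs : 0 ≤ s) (hJ : J.IsLegal τ)
    (i : Fin N) (t₀ : ℝ) :
    ∃ u ≤ t₀, ∃ m, (∀ j < m, σ.Finished s J i j u) ∧ u ≤ J.release i m ∧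
      (∀ t, u ≤ t → t < t₀ → σ.Pending s J i t) ∧
      ∀ B ≤ t₀, (∀ j, B ≤ J.release i j) → B ≤ u := by
  obtain ⟨n, hn⟩ := hJ.exists_le_release i t₀
  induction n generalizing t₀ with
  | zero =>
    exact ⟨t₀, le_rfl, 0, by simp, hn, fun t h1 h2 => absurd h2 h1.not_gt, fun B hB _ => hB⟩
  | succ n ih =>
    rcases le_or_gt t₀ (J.release i n) with hle | hlt
    · exact ih t₀ hle
    by_cases hall : ∀ j < n + 1, σ.Finished s J i j t₀
    · exact ⟨t₀, le_rfl, n + 1, hall, hn, fun t h1 h2 => absurd h2 h1.not_gt, fun B hB _ => hB⟩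
    push Not at hall
    obtain ⟨j, hj, hjf⟩ := hall
    -- Some job up to `n` is still unfinished at `t₀`, so the task is pending throughout `[J.release
    -- i n, t₀)`. It remains to continue backwards from the arrival of job `n`.
    obtain ⟨u, hu, m, hm, hum, hp, hB⟩ := ih _ le_rfl
    refine ⟨u, hu.trans hlt.le, m, hm, hum, fun t h1 h2 => ?_, fun B _ hB' => hB B (hB' n) hB'⟩
    rcases lt_or_ge t (J.release i n) with h3 | h3
    · exact hp t h1 h3
    · exact ⟨j, (hJ.release_mono i (Nat.lt_succ_iff.1 hj)).trans h3,
        fun hf => hjf (h.finished_mono hs h2.le hf)⟩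

/-- If at most the jobs `m, …, n - 1` of a task run in an interval, then the execution the task
receives there is bounded by the total service of these jobs. -/
lemma Schedule.IsValid.mul_runTime_le_sum (h : σ.IsValid s J) (hs : 0 ≤ s)
    (i : Fin N) {a b : ℝ} {m n : ℕ}
    (hjobs : ∀ t j, a ≤ t → t < b → σ.Runs i j t → m ≤ j ∧ j < n) :
    s * σ.runTime i a b ≤ ∑ j ∈ Finset.Ico m n, σ.service s i j b := by
  simp only [Schedule.service_eq, ← Finset.mul_sum]
  refine mul_le_mul_of_nonneg_left ?_ hs
  refine le_trans (measureReal_mono ?_ ?_) (measureReal_biUnion_finset_le _ _)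
  · rintro t ⟨⟨j, hj⟩, h1, h2⟩
    simp only [Set.mem_iUnion]
    exact ⟨j, Finset.mem_Ico.2 (hjobs t j h1 h2 hj), hj, h2⟩
  · exact (measure_biUnion_lt_top (Finset.finite_toSet _) fun j _ =>
      (volume_inter_Iio_ne_top (h.runs_subset i j) b).lt_top).ne

/-- Without backlog at `u`, only jobs arriving in `[u, b)` can run, and separation allows fewer than
`1 + (b - u) / T` of them. -/
lemma Schedule.IsValid.mul_runTime_lt (h : σ.IsValid s J) (hs : 0 < s) (hJ : J.IsLegal τ)
    (i : Fin N) {u b : ℝ} (hub : u ≤ b) {m : ℕ} (hm : ∀ j < m, σ.Finished s J i j u)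
    (hum : u ≤ J.release i m) :
    s * σ.runTime i u b < (τ i).C + (τ i).C / (τ i).T * (b - u) := by
  classical
  have hC := (τ i).C_pos
  have hT := (τ i).T_pos
  have hfin := hJ.exists_le_release i b
  set n := Nat.find hfin with hn
  have hjobs : ∀ t j, u ≤ t → t < b → σ.Runs i j t → m ≤ j ∧ j < n := by
    intro t j h1 h2 hr
    constructor
    · by_contra! hjm
      exact h.unfinished i j t hr (h.finished_mono hs.le h1 (hm j hjm))
    · by_contra! hnj
      have := hJ.release_mono i hnj
      linarith [Nat.find_spec hfin, h.arrived i j t hr]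
  have h1 := h.mul_runTime_le_sum hs.le i hjobs
  have h2 : ∑ j ∈ Finset.Ico m n, σ.service s i j b ≤ (n - m : ℕ) * (τ i).C := by
    refine (Finset.sum_le_card_nsmul _ _ (τ i).C fun j _ =>
      (h.service_le hs (hJ.exec_nonneg i j) b).trans (hJ.exec_le i j)).trans ?_
    simp
  refine (h1.trans h2).trans_lt ?_
  have hnn : 0 ≤ (τ i).C / (τ i).T * (b - u) := mul_nonneg (by positivity) (by linarith)
  -- The subtraction is truncated; if no job counts, strictness comes from `C > 0`. Otherwise the
  -- last job `m + l = n - 1` arrives before `b`.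
  rcases Nat.eq_zero_or_pos (n - m) with h0 | h0
  · rw [h0]; push_cast; linarith
  · obtain ⟨l, hl⟩ := Nat.exists_eq_succ_of_ne_zero h0.ne'
    have hlt : J.release i (m + l) < b := by
      have := Nat.find_min hfin (m := m + l) (by omega)
      linarith
    have hr := hJ.release_add_le i m l
    have hkey : l < (b - u) / (τ i).T := by
      rw [lt_div_iff₀ hT]; linarith
    have := mul_lt_mul_of_pos_right hkey hC
    rw [hl]
    push_cast
    calc ((l : ℝ) + 1) * (τ i).C < (b - u) / (τ i).T * (τ i).C + (τ i).C := by linarith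
      _ = _ := by ring

/-- Pointwise lower bounds on the number of busy tasks integrate to lower bounds on the total run
time. -/
lemma Schedule.IsValid.mul_le_sum_runTime (h : σ.IsValid s J) (H : Finset (Fin N)) {k : Fin N}
    {a b : ℝ} (hab : a ≤ b) (hk : k ∈ H)
    (hfull : ∀ t, a ≤ t → t < b → t ∉ σ.busyTimes k →
      ∃ f : Fin M → Fin N, Function.Injective f ∧ ∀ p, f p ∈ H ∧ t ∈ σ.busyTimes (f p)) :
    M * (b - a) ≤ ∑ i ∈ H, σ.runTime i a b + (M - 1) * σ.runTime k a b := by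
  classical
  have hI : ∀ i, IntegrableOn ((σ.busyTimes i).indicator (1 : ℝ → ℝ)) (Set.Ico a b) := fun i =>
    (integrable_const (1 : ℝ)).indicator (h.measurableSet_busyTimes i)
  have hrun : ∀ i, σ.runTime i a b = ∫ t in Set.Ico a b, (σ.busyTimes i).indicator 1 t :=
    fun i => by
      rw [integral_indicator_one (h.measurableSet_busyTimes i), Schedule.runTime,
        measureReal_restrict_apply (h.measurableSet_busyTimes i)]
  have hconst : M * (b - a) = ∫ _t in Set.Ico a b, (M : ℝ) := by
    rw [setIntegral_const, Real.volume_real_Ico_of_le hab, smul_eq_mul, mul_comm]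
  rw [hconst, hrun k]
  simp_rw [hrun]
  rw [← integral_finsetSum _ (fun i _ => hI i), ← integral_const_mul,
    ← integral_add (integrable_finsetSum _ fun i _ => hI i) ((hI k).const_mul _)]
  refine setIntegral_mono_on (integrable_const _)
    ((integrable_finsetSum _ fun i _ => hI i).add ((hI k).const_mul _)) measurableSet_Ico
    fun t ht => ?_
  have hnn : ∀ i ∈ H, (0 : ℝ) ≤ (σ.busyTimes i).indicator 1 t :=
    fun i _ => Set.indicator_nonneg (fun _ _ => zero_le_one) t
  -- If `k` runs, it contributes 1 to the sum and `M - 1` through the correction term; otherwise `M`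
  -- distinct tasks of `H` run.
  by_cases htk : t ∈ σ.busyTimes k
  · have := Finset.single_le_sum hnn hk
    simp only [Set.indicator_of_mem htk, Pi.one_apply] at this ⊢
    linarith
  · obtain ⟨f, hf, hfH⟩ := hfull t ht.1 ht.2 htk
    have h1 : ∑ i ∈ Finset.univ.image f, (σ.busyTimes i).indicator (1 : ℝ → ℝ) t = M := by
      rw [Finset.sum_image hf.injOn]
      simp [Set.indicator_of_mem (hfH _).2]
    have h2 : ∑ i ∈ Finset.univ.image f, (σ.busyTimes i).indicator (1 : ℝ → ℝ) t ≤
        ∑ i ∈ H, (σ.busyTimes i).indicator (1 : ℝ → ℝ) t :=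
      Finset.sum_le_sum_of_subset_of_nonneg
        (Finset.image_subset_iff.2 fun p _ => (hfH p).1) fun i hi _ => hnn i hi
    simp only [Set.indicator_of_notMem htk, mul_zero, add_zero]
    linarith

/-- A pending task of a fixed-priority schedule executes, unless all processors execute distinct
tasks of higher priority. -/
lemma exists_injective_of_pending {prio : PriorityRule}
    (h : globalFixedPriority M prio N τ s J σ) (hJ : J.IsLegal τ) {i : Fin N} {t : ℝ}
    (hp : σ.Pending s J i t) (ht : t ∉ σ.busyTimes i) :
    ∃ f : Fin M → Fin N, Function.Injective f ∧
      ∀ p, prio N τ (f p) < prio N τ i ∧ t ∈ σ.busyTimes (f p) := by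
  classical
  have hex : ∃ j, ¬ σ.Finished s J i j t := hp.imp fun _ hj => hj.2
  obtain ⟨j₀, hr₀, hf₀⟩ := hp
  -- The earliest unfinished job has arrived, since it does not come after the pending one, and
  -- hence is ready.
  have hready : σ.Ready s J i (Nat.find hex) t :=
    ⟨(hJ.release_mono i (Nat.find_min' hex hf₀)).trans hr₀, Nat.find_spec hex,
      fun j' hj' => not_not.1 (Nat.find_min hex hj')⟩
  choose f g hfg hlt using h.2.2 i _ t hready fun hr => ht ⟨_, hr⟩
  refine ⟨f, fun p q hpq => ?_, fun p => ⟨hlt p, g p, p, hfg p⟩⟩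
  have hq := hfg q
  rw [← hpq] at hq
  exact h.1.sequential p q t (f p) (g p) (g q) (hfg p) hq

/-- If a job misses its deadline, then the execution received by its task since the beginning of
the busy interval is less than the length of that interval. -/
lemma exists_busy_start_of_miss {prio : PriorityRule}
    (h : globalFixedPriority M prio N τ s J σ) (hs : 0 < s) (hJ : J.IsLegal τ)
    (hF : Feasible M 1 τ) {k : Fin N} {j : ℕ}
    (hmiss : ¬ σ.Finished s J k j (J.release k j + (τ k).D)) :
    ∃ u ≤ J.release k j, (∀ B, (∀ j, B ≤ J.release k j) → B ≤ u) ∧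
      (∀ t, u ≤ t → t < J.release k j + (τ k).D → σ.Pending s J k t) ∧
      s * σ.runTime k u (J.release k j + (τ k).D) < J.release k j + (τ k).D - u := by
  have hv := h.1
  have hD := (τ k).D_pos
  obtain ⟨u, hu, m, hm, hum, hp, hB⟩ :=
    hv.exists_busy_start hs.le hJ k (J.release k j + (τ k).D)
  have hmj : m ≤ j := by
    by_contra! hlt
    exact hmiss (hv.finished_mono hs.le hu (hm j hlt))
  have huj : u ≤ J.release k j := hum.trans (hJ.release_mono k hmj)
  refine ⟨u, huj, fun B hB' => hB B ((hB' j).trans (by linarith)) hB', hp, ?_⟩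
  have hjobs : ∀ t j', u ≤ t → t < J.release k j + (τ k).D → σ.Runs k j' t →
      m ≤ j' ∧ j' < j + 1 := by
    intro t j' h1 h2 hr
    constructor
    · by_contra! hjm
      exact hv.unfinished k j' t hr (hv.finished_mono hs.le h1 (hm j' hjm))
    -- A later job cannot run before the deadline: service is in order and job `j` is unfinished
    -- until then.
    · by_contra! hjj
      exact hmiss (hv.finished_mono hs.le h2.le ((h.2.1 k j' t hr).2.2 j hjj))
  refine (hv.mul_runTime_le_sum hs.le k hjobs).trans_lt ?_
  have h1 : ∑ j' ∈ Finset.Ico m (j + 1), σ.service s k j' (J.release k j + (τ k).D) <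
      ∑ _j' ∈ Finset.Ico m (j + 1), (τ k).C := by
    refine Finset.sum_lt_sum
      (fun j' _ => (hv.service_le hs (hJ.exec_nonneg k j') _).trans (hJ.exec_le k j'))
      ⟨j, Finset.mem_Ico.2 ⟨hmj, j.lt_succ_self⟩, ?_⟩
    exact (not_le.1 hmiss).trans_le (hJ.exec_le k j)
  -- The `l + 1` jobs `m, …, m + l` need at most `l * T + D`, and job `m + l` arrives at least `l *
  -- T` after `u`.
  obtain ⟨l, rfl⟩ := Nat.exists_eq_add_of_le hmj
  have h2 := hF.task_demand_le k l
  have h3 := hJ.release_add_le k m l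
  have h4 : m + l + 1 - m = l + 1 := by omega
  simp only [Finset.sum_const, Nat.card_Ico, h4, nsmul_eq_mul] at h1
  push_cast at h1
  linarith

/-- The excess of the execution received by the tasks in `H` in `[t, b)` over `c * (b - t)` attains
its maximum over `t ∈ [B, u]`. -/
lemma Schedule.IsValid.exists_forall_excess_le (h : σ.IsValid s J) (H : Finset (Fin N)) (c : ℝ)
    {B u b : ℝ} (hB : ∀ i j, B ≤ J.release i j) (hBu : B ≤ u) (hub : u ≤ b) :
    ∃ t₀, B ≤ t₀ ∧ t₀ ≤ u ∧ ∀ t, B ≤ t → t ≤ u →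
      s * ∑ i ∈ H, σ.runTime i t b - c * (b - t) ≤
        s * ∑ i ∈ H, σ.runTime i t₀ b - c * (b - t₀) := by
  have hcont : ContinuousOn (fun t => s * ∑ i ∈ H, σ.runTime i t b - c * (b - t))
      (Set.Icc B u) := by
    have h1 : Continuous fun t => s * ∑ i ∈ H,
        (timeBefore (σ.busyTimes i) b - timeBefore (σ.busyTimes i) t) - c * (b - t) := by
      have := fun i => continuous_timeBefore (h.measurableSet_busyTimes i)
        (h.busyTimes_subset hB i)
      fun_prop
    refine h1.continuousOn.congr fun t ht => ?_
    simp only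
    congr 2
    refine Finset.sum_congr rfl fun i _ => ?_
    rw [timeBefore_add (h.measurableSet_busyTimes i) (h.busyTimes_subset hB i)
      (ht.2.trans hub), Schedule.runTime]
    ring
  obtain ⟨t₀, ht₀, hmax⟩ := isCompact_Icc.exists_isMaxOn ⟨B, Set.left_mem_Icc.2 hBu⟩ hcont
  exact ⟨t₀, ht₀.1, ht₀.2, fun t h1 h2 => hmax ⟨h1, h2⟩⟩

/-- At speed `3 - 1 / M`, every global deadline-monotonic schedule of a feasible task set meets all
deadlines. -/
theorem meetsDeadlines_of_globalFixedPriority (hM : 2 ≤ M) {prio : PriorityRule}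
    (hDM : prio.IsDeadlineMonotonic) (hF : Feasible M 1 τ) (hJ : J.IsLegal τ)
    (h : globalFixedPriority M prio N τ (3 - 1 / (M : ℝ)) J σ) :
    σ.MeetsDeadlines (3 - 1 / (M : ℝ)) τ J := by
  have hM2 : (2 : ℝ) ≤ M := by exact_mod_cast hM
  have hMs : M * (3 - 1 / (M : ℝ)) = 3 * M - 1 := by field_simp
  set s := 3 - 1 / (M : ℝ)
  have hs : 0 < s := by
    by_contra! hneg
    nlinarith
  have hv := h.1
  intro k j
  by_contra hmiss
  obtain ⟨u, huj, hBu, hpend, hlt⟩ := exists_busy_start_of_miss h hs hJ hF hmiss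
  set d := J.release k j + (τ k).D with hd
  have hDk := (τ k).D_pos
  have hud : u ≤ d := by linarith
  let H : Finset (Fin N) := Finset.univ.filter fun i => prio N τ i ≤ prio N τ k
  have hkH : k ∈ H := by simp [H]
  have hDH : ∀ i ∈ H, (τ i).D ≤ (τ k).D := by
    intro i hi
    rcases (Finset.mem_filter.1 hi).2.lt_or_eq with h1 | h1
    · exact hDM.monotone N τ i k h1
    · rw [hDM.unique N τ h1]
  have hwork : ∀ i ∈ H, ∀ a b, a ≤ b → (∀ t, a ≤ t → t < b → σ.Pending s J i t) →
      (3 * M - 1) * (b - a) ≤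
        s * ∑ i ∈ H, σ.runTime i a b + (M - 1) * (s * σ.runTime i a b) := by
    intro i hi a b hab hp
    have h1 := hv.mul_le_sum_runTime H hab hi (fun t h1 h2 hti => by
      obtain ⟨f, hf, hf'⟩ := exists_injective_of_pending h hJ (hp t h1 h2) hti
      exact ⟨f, hf, fun p => ⟨Finset.mem_filter.2 ⟨Finset.mem_univ _,
        (hf' p).1.le.trans (Finset.mem_filter.1 hi).2⟩, (hf' p).2⟩⟩)
    have h2 := mul_le_mul_of_nonneg_left h1 hs.le
    rw [← hMs]
    linarith
  obtain ⟨B, hB⟩ := hJ.exists_forall_le_release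
  obtain ⟨t₀, hBt, htu, hmax⟩ :=
    hv.exists_forall_excess_le H (2 * M) hB (hBu B (hB k)) hud
  have htd : t₀ ≤ d := htu.trans hud
  have hpos : 0 < s * ∑ i ∈ H, σ.runTime i t₀ d - 2 * M * (d - t₀) := by
    refine lt_of_lt_of_le ?_ (hmax u (hBu B (hB k)) le_rfl)
    -- Of the `(3M - 1)(d - u)` units, less than `(M - 1)(d - u)` is covered by the term for `k`
    -- itself.
    have h1 := hwork k hkH u d hud hpend
    have h2 := mul_lt_mul_of_pos_left hlt (show (0 : ℝ) < M - 1 by linarith)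
    linarith
  have hup : ∀ i ∈ H, s * σ.runTime i t₀ d < (τ i).C + (τ i).C / (τ i).T * (d - t₀) := by
    intro i hi
    obtain ⟨v, hvt, m, hm, hvm, hp, hvB⟩ := hv.exists_busy_start hs.le hJ i t₀
    have hadd : ∀ i, σ.runTime i v d = σ.runTime i v t₀ + σ.runTime i t₀ d :=
      fun i => hv.runTime_add i hvt htd
    have h1 := hv.mul_runTime_lt hs hJ i (hvt.trans htd) hm hvm
    have h2 := hwork i hi v t₀ hvt hp
    have h3 := hmax v (hvB B hBt (hB i)) (hvt.trans htu)
    simp only [hadd, Finset.sum_add_distrib] at h3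
    -- By maximality of `t₀`, all of `H` accounts for at most `2M(t₀ - v)` of the `(3M - 1)(t₀ - v)`
    -- units; the term for `i` covers the rest.
    have h4 : t₀ - v ≤ s * σ.runTime i v t₀ := by
      refine le_of_mul_le_mul_left ?_ (show (0 : ℝ) < M - 1 by linarith)
      linarith
    have h5 : (τ i).C / (τ i).T * (t₀ - v) ≤ t₀ - v :=
      mul_le_of_le_one_left (by linarith) ((div_le_one (τ i).T_pos).2 (hF.C_le_T i))
    rw [hadd] at h1
    have h6 : (τ i).C / (τ i).T * (d - v) =
        (τ i).C / (τ i).T * (d - t₀) + (τ i).C / (τ i).T * (t₀ - v) := by ring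
    linarith
  have hsum := Finset.sum_lt_sum_of_nonempty ⟨k, hkH⟩ hup
  rw [← Finset.mul_sum, Finset.sum_add_distrib, ← Finset.sum_mul] at hsum
  have hC := hF.sum_C_le H hDk.le hDH
  have hU : ∑ i ∈ H, (τ i).C / (τ i).T ≤ M :=
    (Finset.sum_le_sum_of_subset_of_nonneg (Finset.subset_univ H)
      fun i _ _ => div_nonneg (τ i).C_pos.le (τ i).T_pos.le).trans hF.sum_utilization_le
  have h1 := mul_le_mul_of_nonneg_right hU (show 0 ≤ d - t₀ by linarith)
  -- The interval contains the whole deadline window of the missed job, as `t₀ ≤ u ≤ J.release k j`.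
  have h2 : (M : ℝ) * (τ k).D ≤ M * (d - t₀) :=
    mul_le_mul_of_nonneg_left (by linarith) (by linarith)
  linarith

end Analysis

/-! ### Serving one task in order on a given set of available times. -/

section SingleTask

variable (A : Set ℝ) (s : ℝ) (r e : ℕ → ℝ)

/-- The times at which all jobs before job `j` of a task are finished, if the jobs arrive at the
times `r`, need the execution times `e`, and are served in order of arrival at speed `s` at all
times in `A` at which one of them is ready. -/
def predecessorsDone : ℕ → Set ℝ
  | 0 => Set.univ
  | j + 1 => predecessorsDone j ∩
      {t | e j ≤ s * timeBefore (A ∩ (Set.Ici (r j) ∩ predecessorsDone j)) t}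

/-- The times in `A` at which job `j` could be served, if it never finished. -/
def slots (j : ℕ) : Set ℝ := A ∩ (Set.Ici (r j) ∩ predecessorsDone A s r e j)

/-- The times at which job `j` is finished. -/
def doneTimes (j : ℕ) : Set ℝ := {t | e j ≤ s * timeBefore (slots A s r e j) t}

/-- The times at which job `j` is served. -/
def serveTimes (j : ℕ) : Set ℝ := slots A s r e j \ doneTimes A s r e j

variable {A s r e}

lemma mem_predecessorsDone {j : ℕ} {t : ℝ} :
    t ∈ predecessorsDone A s r e j ↔ ∀ j' < j, t ∈ doneTimes A s r e j' := by
  induction j with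
  | zero => simp [predecessorsDone]
  | succ j ih =>
    rw [predecessorsDone, Set.mem_inter_iff, ih, Nat.forall_lt_succ_right]
    rfl

lemma slots_subset (j : ℕ) : slots A s r e j ⊆ Set.Ici (r j) := fun _ h => h.2.1

lemma serveTimes_subset (j : ℕ) : serveTimes A s r e j ⊆ Set.Ici (r j) :=
  Set.sdiff_subset.trans (slots_subset j)

lemma isUpperSet_predecessorsDone (hA : MeasurableSet A) (hs : 0 ≤ s) (j : ℕ) :
    IsUpperSet (predecessorsDone A s r e j) := by
  induction j with
  | zero => exact isUpperSet_univ
  | succ j ih =>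
    refine ih.inter fun t t' htt ht => ?_
    exact le_trans ht (mul_le_mul_of_nonneg_left (timeBefore_mono
      (hA.inter (measurableSet_Ici.inter ih.ordConnected.measurableSet))
      (slots_subset (A := A) (s := s) (e := e) j) htt) hs)

lemma measurableSet_slots (hA : MeasurableSet A) (hs : 0 ≤ s) (j : ℕ) :
    MeasurableSet (slots A s r e j) :=
  hA.inter (measurableSet_Ici.inter
    (isUpperSet_predecessorsDone hA hs j).ordConnected.measurableSet)

lemma isUpperSet_doneTimes (hA : MeasurableSet A) (hs : 0 ≤ s) (j : ℕ) :
    IsUpperSet (doneTimes A s r e j) := fun _ _ htt ht =>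
  le_trans ht (mul_le_mul_of_nonneg_left
    (timeBefore_mono (measurableSet_slots hA hs j) (slots_subset j) htt) hs)

lemma measurableSet_serveTimes (hA : MeasurableSet A) (hs : 0 ≤ s) (j : ℕ) :
    MeasurableSet (serveTimes A s r e j) :=
  (measurableSet_slots hA hs j).diff (isUpperSet_doneTimes hA hs j).ordConnected.measurableSet

lemma timeBefore_serveTimes_of_forall_lt {j : ℕ} {t : ℝ}
    (ht : ∀ u < t, u ∉ doneTimes A s r e j) :
    timeBefore (serveTimes A s r e j) t = timeBefore (slots A s r e j) t := by
  unfold timeBefore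
  congr 1
  ext u
  exact ⟨fun hu => ⟨hu.1.1, hu.2⟩, fun hu => ⟨⟨hu.1, ht u hu.2⟩, hu.2⟩⟩

/-- Completion is defined by hypothetical service that never stops, which avoids circularity. Both
notions agree because the two kinds of service coincide up to the first completion instant. -/
lemma le_timeBefore_serveTimes_iff (hA : MeasurableSet A) (hs : 0 < s) {j : ℕ} (t : ℝ) :
    e j ≤ s * timeBefore (serveTimes A s r e j) t ↔ t ∈ doneTimes A s r e j := by
  constructor
  · intro h
    refine le_trans h (mul_le_mul_of_nonneg_left ?_ hs.le)
    exact measureReal_mono (Set.inter_subset_inter_left _ Set.sdiff_subset)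
      (volume_inter_Iio_ne_top (slots_subset j) t)
  · intro h
    rcases le_or_gt (e j) 0 with he | he
    · exact he.trans (mul_nonneg hs.le (timeBefore_nonneg _ _))
    have hrt : r j ≤ t := by
      by_contra! hlt
      have h' : e j ≤ s * timeBefore (slots A s r e j) t := h
      rw [timeBefore_of_le (slots_subset j) hlt.le] at h'
      linarith
    have hcont := continuous_timeBefore (measurableSet_slots (r := r) (e := e) hA hs.le j)
      (slots_subset j)
    obtain ⟨f, hf, hfe⟩ := intermediate_value_Icc hrt (hcont.const_mul s).continuousOn
      (show e j ∈ Set.Icc _ _ from ⟨by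
        rw [timeBefore_of_le (slots_subset j) le_rfl]; linarith, h⟩)
    -- The first completion instant `g` exists because the service is continuous in time, so the set
    -- of completion times is closed.
    obtain ⟨g, hg, hgmin⟩ := (isCompact_Icc.inter_right
      (isClosed_le continuous_const (hcont.const_mul s) :
        IsClosed (doneTimes A s r e j))).exists_isLeast ⟨f, hf, hfe.ge⟩
    have hbefore : ∀ u < g, u ∉ doneTimes A s r e j := by
      intro u hu hmem
      rcases le_or_gt (r j) u with h1 | h1
      · exact hu.not_ge (hgmin ⟨⟨h1, hu.le.trans hg.1.2⟩, hmem⟩)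
      · have h' : e j ≤ s * timeBefore (slots A s r e j) u := hmem
        rw [timeBefore_of_le (slots_subset j) h1.le] at h'
        linarith
    have h1 := timeBefore_serveTimes_of_forall_lt hbefore
    have h2 : e j ≤ s * timeBefore (slots A s r e j) g := hg.2
    rw [← h1] at h2
    exact h2.trans (mul_le_mul_of_nonneg_left (timeBefore_mono
      (measurableSet_serveTimes hA hs.le j) (serveTimes_subset j) hg.1.2) hs.le)

lemma serveTimes_unique {j j' : ℕ} {t : ℝ} (h : t ∈ serveTimes A s r e j)
    (h' : t ∈ serveTimes A s r e j') : j = j' := by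
  rcases lt_trichotomy j j' with hlt | heq | hlt
  · exact absurd (mem_predecessorsDone.1 h'.1.2.2 j hlt) h.2
  · exact heq
  · exact absurd (mem_predecessorsDone.1 h.1.2.2 j' hlt) h'.2

end SingleTask

/-- For every `p` below the cardinality of a finite set there is an element with exactly `p`
smaller ones. -/
lemma exists_card_filter_lt_eq {ι : Type*} {π : ι → ℕ} (hπ : Function.Injective π) (S : Finset ι)
    {p : ℕ} (hp : p < S.card) : ∃ x ∈ S, (S.filter fun y => π y < π x).card = p := by
  classical
  induction hn : S.card generalizing S with
  | zero => omega
  | succ n ih =>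
    -- The maximal element has rank `n`; removing it leaves the ranks of all others unchanged.
    obtain ⟨x, hx, hmax⟩ := S.exists_max_image π (Finset.card_pos.1 (by omega))
    have hcard : (S.erase x).card = n := by rw [Finset.card_erase_of_mem hx]; omega
    rcases Nat.lt_or_ge p n with h | h
    · obtain ⟨y, hy, hyp⟩ := ih (S.erase x) (by omega) hcard
      refine ⟨y, Finset.mem_of_mem_erase hy, ?_⟩
      rw [← hyp]
      congr 1
      ext z
      simp only [Finset.mem_filter, Finset.mem_erase]
      refine ⟨fun hz => ⟨⟨?_, hz.1⟩, hz.2⟩, fun hz => ⟨hz.1.2, hz.2⟩⟩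
      rintro rfl
      exact hz.2.not_ge (hmax y (Finset.mem_of_mem_erase hy))
    · refine ⟨x, hx, ?_⟩
      have : (S.filter fun y => π y < π x) = S.erase x := by
        ext z
        simp only [Finset.mem_filter, Finset.mem_erase]
        exact ⟨fun hz => ⟨fun h => by simp [h] at hz, hz.1⟩,
          fun hz => ⟨hz.2, lt_of_le_of_ne (hmax z hz.2) fun h => hz.1 (hπ h)⟩⟩
      rw [this]
      omega

/-! ### Existence of global fixed-priority schedules. -/

section Construction

variable {N : ℕ} (M : ℕ) (π : Fin N → ℕ) (s : ℝ) (J : JobSeq N)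

open Classical in
/-- The times at which job `j` of task `i` executes under global fixed-priority scheduling, by
recursion on the priority of the task. -/
noncomputable def fixedPriorityTimes : Fin N → ℕ → Set ℝ :=
  (InvImage.wf π Nat.lt_wfRel.wf).fix fun i higher =>
    serveTimes {t | (Finset.univ.filter fun i' =>
      ∃ h : π i' < π i, ∃ j, t ∈ higher i' h j).card < M} s (J.release i) (J.exec i)

open Classical in
/-- The tasks of higher priority than `i` that execute at time `t`. -/
noncomputable def higherRunning (i : Fin N) (t : ℝ) : Finset (Fin N) :=
  Finset.univ.filter fun k => π k < π i ∧ ∃ j, t ∈ fixedPriorityTimes M π s J k j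

/-- The times at which some processor does not execute a task of higher priority than `i`. -/
def supply (i : Fin N) : Set ℝ := {t | (higherRunning M π s J i t).card < M}

variable {M π s J}

lemma mem_higherRunning {i i' : Fin N} {t : ℝ} :
    i' ∈ higherRunning M π s J i t ↔
      π i' < π i ∧ ∃ j, t ∈ fixedPriorityTimes M π s J i' j := by
  simp [higherRunning]

variable (M π s J) in
open Classical in
lemma fixedPriorityTimes_eq (i : Fin N) :
    fixedPriorityTimes M π s J i =
      serveTimes (supply M π s J i) s (J.release i) (J.exec i) := by
  rw [fixedPriorityTimes, WellFounded.fix_eq]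
  refine congrArg (serveTimes · s (J.release i) (J.exec i)) (Set.ext fun t => ?_)
  have h : (Finset.univ.filter fun i' => ∃ _ : π i' < π i, ∃ j,
      t ∈ fixedPriorityTimes M π s J i' j) = higherRunning M π s J i t := by
    ext i'
    rw [mem_higherRunning, Finset.mem_filter, exists_prop]
    simp
  exact iff_of_eq (congrArg (fun S : Finset (Fin N) => S.card < M) h)

lemma measurable_card_higherRunning {i : Fin N}
    (h : ∀ i', π i' < π i → ∀ j, MeasurableSet (fixedPriorityTimes M π s J i' j)) :
    Measurable fun t => (higherRunning M π s J i t).card := by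
  classical
  simp only [higherRunning, Finset.card_filter]
  refine Finset.measurable_sum _ fun i' _ => ?_
  by_cases hi : π i' < π i
  · refine Measurable.ite ?_ measurable_const measurable_const
    have : {t | π i' < π i ∧ ∃ j, t ∈ fixedPriorityTimes M π s J i' j} =
        ⋃ j, fixedPriorityTimes M π s J i' j := by ext t; simp [hi]
    rw [this]
    exact MeasurableSet.iUnion fun j => h i' hi j
  · simp [hi]

lemma measurableSet_fixedPriorityTimes (hs : 0 ≤ s) (i : Fin N) (j : ℕ) :
    MeasurableSet (fixedPriorityTimes M π s J i j) := by
  induction hn : π i using Nat.strong_induction_on generalizing i j with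
  | _ n ih =>
    subst hn
    rw [fixedPriorityTimes_eq]
    refine measurableSet_serveTimes ?_ hs j
    exact measurableSet_lt (measurable_card_higherRunning fun i' hi j => ih _ hi i' j rfl)
      measurable_const

lemma measurableSet_supply (hs : 0 ≤ s) (i : Fin N) : MeasurableSet (supply M π s J i) :=
  measurableSet_lt (measurable_card_higherRunning fun i' _ j =>
    measurableSet_fixedPriorityTimes hs i' j) measurable_const

lemma card_higherRunning_lt {i : Fin N} {j : ℕ} {t : ℝ}
    (h : t ∈ fixedPriorityTimes M π s J i j) : (higherRunning M π s J i t).card < M := by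
  rw [fixedPriorityTimes_eq] at h
  exact h.1.1

/-- A running task is itself counted for every task of lower priority. Hence the counts of running
tasks are distinct and can serve as processor numbers. -/
lemma card_higherRunning_strictMono {i i' : Fin N} {j : ℕ} {t : ℝ}
    (h : t ∈ fixedPriorityTimes M π s J i j) (hlt : π i < π i') :
    (higherRunning M π s J i t).card < (higherRunning M π s J i' t).card := by
  refine Finset.card_lt_card ⟨fun k hk => ?_, fun hsub => ?_⟩
  · rw [mem_higherRunning] at hk ⊢
    exact ⟨hk.1.trans hlt, hk.2⟩
  · have := hsub (mem_higherRunning.2 ⟨hlt, j, h⟩)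
    exact lt_irrefl _ (mem_higherRunning.1 this).1

lemma fixedPriorityTimes_unique (hπ : Function.Injective π) {i i' : Fin N} {j j' : ℕ} {t : ℝ}
    (h : t ∈ fixedPriorityTimes M π s J i j) (h' : t ∈ fixedPriorityTimes M π s J i' j')
    (hcard : (higherRunning M π s J i t).card = (higherRunning M π s J i' t).card) :
    (i, j) = (i', j') := by
  rcases lt_trichotomy (π i) (π i') with hlt | heq | hlt
  · exact absurd hcard (card_higherRunning_strictMono h hlt).ne
  · obtain rfl := hπ heq
    rw [fixedPriorityTimes_eq] at h h'
    rw [serveTimes_unique h h']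
  · exact absurd hcard (card_higherRunning_strictMono h' hlt).ne'

variable (M π s J) in
open Classical in
/-- The global fixed-priority schedule: a running task is executed by the processor whose number
is the number of running tasks of higher priority. -/
noncomputable def fixedPrioritySchedule : Schedule M N := fun p t =>
  if h : ∃ x : Fin N × ℕ, t ∈ fixedPriorityTimes M π s J x.1 x.2 ∧
      (higherRunning M π s J x.1 t).card = p
  then some h.choose else none

lemma fixedPrioritySchedule_eq_some (hπ : Function.Injective π) {p : Fin M} {t : ℝ} {i : Fin N}
    {j : ℕ} : fixedPrioritySchedule M π s J p t = some (i, j) ↔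
      t ∈ fixedPriorityTimes M π s J i j ∧ (higherRunning M π s J i t).card = p := by
  unfold fixedPrioritySchedule
  split_ifs with h
  · rw [Option.some.injEq]
    constructor
    · intro heq
      have := h.choose_spec
      rwa [heq] at this
    · intro h'
      exact fixedPriorityTimes_unique hπ h.choose_spec.1 h'.1 (h.choose_spec.2.trans h'.2.symm)
  · simp only [false_iff]
    exact fun h' => h ⟨(i, j), h'⟩

lemma fixedPrioritySchedule_runs (hπ : Function.Injective π) {t : ℝ} {i : Fin N} {j : ℕ} :
    (fixedPrioritySchedule M π s J).Runs i j t ↔ t ∈ fixedPriorityTimes M π s J i j := by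
  simp only [Schedule.Runs, fixedPrioritySchedule_eq_some hπ]
  exact ⟨fun ⟨_, h, _⟩ => h, fun h => ⟨⟨_, card_higherRunning_lt h⟩, h, rfl⟩⟩

lemma fixedPrioritySchedule_finished (hπ : Function.Injective π) (hs : 0 < s) {t : ℝ} {i : Fin N}
    {j : ℕ} : (fixedPrioritySchedule M π s J).Finished s J i j t ↔
      t ∈ doneTimes (supply M π s J i) s (J.release i) (J.exec i) j := by
  rw [Schedule.Finished, Schedule.service_eq]
  simp only [fixedPrioritySchedule_runs hπ, Set.ofPred_mem_eq, fixedPriorityTimes_eq]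
  exact le_timeBefore_serveTimes_iff (measurableSet_supply hs.le i) hs t

lemma fixedPrioritySchedule_ready (hπ : Function.Injective π) (hs : 0 < s) {t : ℝ} {i : Fin N}
    {j : ℕ} : (fixedPrioritySchedule M π s J).Ready s J i j t ↔
      J.release i j ≤ t ∧ t ∉ doneTimes (supply M π s J i) s (J.release i) (J.exec i) j ∧
        t ∈ predecessorsDone (supply M π s J i) s (J.release i) (J.exec i) j := by
  simp only [Schedule.Ready, fixedPrioritySchedule_finished hπ hs, mem_predecessorsDone]

lemma fixedPrioritySchedule_isValid (hπ : Function.Injective π) (hs : 0 < s) :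
    (fixedPrioritySchedule M π s J).IsValid s J where
  measurable p i j := by
    simp only [fixedPrioritySchedule_eq_some hπ]
    exact (measurableSet_fixedPriorityTimes hs.le i j).inter (measurableSet_eq_fun
      (measurable_card_higherRunning fun i' _ j => measurableSet_fixedPriorityTimes hs.le i' j)
      measurable_const)
  sequential p q t i j j' hp hq := by
    rw [fixedPrioritySchedule_eq_some hπ] at hp hq
    exact Fin.ext (hp.2.symm.trans hq.2)
  arrived i j t h := by
    rw [fixedPrioritySchedule_runs hπ, fixedPriorityTimes_eq] at h
    exact h.1.2.1
  unfinished i j t h := by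
    rw [fixedPrioritySchedule_runs hπ, fixedPriorityTimes_eq] at h
    rw [fixedPrioritySchedule_finished hπ hs]
    exact h.2

/-- If at least `M` tasks of higher priority run, then each processor executes one of them. -/
lemma exists_higher_of_notMem_supply (hπ : Function.Injective π) {i : Fin N} {t : ℝ}
    (h : t ∉ supply M π s J i) (p : Fin M) :
    ∃ i' j', fixedPrioritySchedule M π s J p t = some (i', j') ∧ π i' < π i := by
  obtain ⟨x, hx, hxp⟩ := exists_card_filter_lt_eq hπ (higherRunning M π s J i t)
    (p.2.trans_le (not_lt.1 h))
  obtain ⟨hlt, j, hj⟩ := mem_higherRunning.1 hx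
  refine ⟨x, j, (fixedPrioritySchedule_eq_some hπ).2 ⟨hj, ?_⟩, hlt⟩
  rw [← hxp]
  congr 1
  ext y
  simp only [Finset.mem_filter, mem_higherRunning]
  exact ⟨fun hy => ⟨⟨hy.1.trans hlt, hy.2⟩, hy.1⟩, fun hy => ⟨hy.2, hy.1.2⟩⟩

end Construction

/-- Every job sequence has a global fixed-priority schedule. -/
theorem exists_globalFixedPriority {M N : ℕ} {prio : PriorityRule} {τ : TaskSet N} {s : ℝ}
    (hs : 0 < s) (hπ : Function.Injective (prio N τ)) (J : JobSeq N) :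
    ∃ σ : Schedule M N, globalFixedPriority M prio N τ s J σ := by
  refine ⟨fixedPrioritySchedule M (prio N τ) s J, fixedPrioritySchedule_isValid hπ hs, ?_, ?_⟩
  · intro i j t h
    rw [fixedPrioritySchedule_runs hπ, fixedPriorityTimes_eq] at h
    exact (fixedPrioritySchedule_ready hπ hs).2 ⟨h.1.2.1, h.2, h.1.2.2⟩
  · intro i j t hready hnot p
    rw [fixedPrioritySchedule_ready hπ hs] at hready
    rw [fixedPrioritySchedule_runs hπ, fixedPriorityTimes_eq] at hnot
    exact exists_higher_of_notMem_supply hπ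
      (fun h => hnot ⟨⟨h, hready.1, hready.2.2⟩, hready.2.1⟩) p

end GlobalScheduling

theorem theorem5p2 (M : ℕ) (hM : 2 ≤ M) (prio : GlobalScheduling.PriorityRule)
    (hDM : prio.IsDeadlineMonotonic) :
    (GlobalScheduling.globalFixedPriority M prio).HasSpeedupBound (3 - 1 / (M : ℝ)) := by
  intro N τ hF J hJ
  have hM2 : (2 : ℝ) ≤ M := by exact_mod_cast hM
  have hs : (0 : ℝ) < 3 - 1 / (M : ℝ) := by
    have : 1 / (M : ℝ) ≤ 1 := (div_le_one (by linarith)).2 (by linarith)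
    linarith
  exact ⟨GlobalScheduling.exists_globalFixedPriority hs (hDM.unique N τ) J, fun σ h =>
    ⟨h.1, GlobalScheduling.meetsDeadlines_of_globalFixedPriority hM hDM hF hJ h⟩⟩
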